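/- Let $G=(V,E)$ be a finite, strongly connected directed graph (loops allowed), and for $x\in V$ let $S_x=\{y\in V: x\to y\}$. Let $(X_n)_{n\ge 0}$ be a random walk on $G$ (so that $X_{n+1}\in S_{X_n}$ almost surely), together with random or deterministic initial states $\rho_0(x)\in S_x$, $x\in V$. Put $\tau^x_0=0$, let $\tau^x_k=\min\{j>\tau^x_{k-1}: X_j=x\}$ for $k\ge1$ (with $\min\emptyset=\infty$), and define the local chain at $x$ by $L^x(k)=X_{\tau^x_k+1}$ for $k\ge 1$ with $\tau^x_k<\infty$, and by $L^x(0)=X_1$ if $X_0=x$ and $L^x(0)=\rho_0(x)$ otherwise. Suppose that $(X_n)$ is a locally Markov walk, i.e. for every $x\in V$ the process $(L^x(k))_{k\ge 0}$ is a Markov chain on $S_x$ with some transition matrix $M_x=(m_x(y,z))_{y,z\in S_x}$: for all $k\ge 0$ and all $l_0,\dots,l_k,z\in S_x$, $$\mathbb P\big[\tau^x_{k+1}<\infty,\ L^x(0)=l_0,\dots,L^x(k)=l_k,\ L^x(k+1)=z\big]=m_x(l_k,z)\,\mathbb P\big[\tau^x_{k+1}<\infty,\ L^x(0)=l_0,\dots,L^x(k)=l_k\big].$$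 Assume that $m_x(y,z)>0$ for all $x\in V$ and $y,z\in S_x$. Let $Q$ be the matrix indexed over $V\times V$ whose row at $x$ is the stationary distribution of $M_x$ (extended by $0$ outside $S_x$), and let $\pi$ be the stationary distribution of $Q$, i.e. the probability vector with $\pi Q=\pi$. Then for every $f:V\to\mathbb R$, $$\lim_{t\to\infty}\frac1t\sum_{n=0}^{t}f(X_n)=\sum_{x\in V}f(x)\pi(x)\quad\text{almost surely.}$$ In particular, for every $x\in V$, the proportion of visits $\frac1t\,\#\{0\le n<t: X_n=x\}$ to $x$ converges to $\pi(x)$ almost surely as $t\to\infty$. -/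

import Mathlib

open MeasureTheory Filter Topology

/-- A directed graph is strongly connected if every vertex can be reached from every vertex along a
directed path. -/
def Digraph.IsStronglyConnected {V : Type*} (G : Digraph V) : Prop :=
  ∀ x y : V, Relation.ReflTransGen G.Adj x y

/-- `M` is the transition matrix of a Markov chain with state space `S ⊆ V`, regarded as a matrix
over `V` by filling in zeros in all the rows and columns outside `S`. -/
structure IsTransitionMatrixOn {V : Type*} [Fintype V] (S : Set V) (M : Matrix V V ℝ) : Prop where
  nonneg : ∀ y z, 0 ≤ M y z
  row_sum : ∀ y ∈ S, ∑ z, M y z = 1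
  zero_row : ∀ y ∉ S, ∀ z, M y z = 0
  zero_col : ∀ z ∉ S, ∀ y, M y z = 0

/-- `q` is a stationary distribution of `M`: a probability vector with `q M = q`. (If `M` is padded
with zeros outside `S`, then such a `q` automatically vanishes outside `S`.) -/
def IsStationaryDistribution {V : Type*} [Fintype V] (q : V → ℝ) (M : Matrix V V ℝ) : Prop :=
  q ∈ stdSimplex ℝ V ∧ Matrix.vecMul q M = q

/-- The visit times of the trajectory `w` to `x`: `τ₀ = 0` and `τₖ₊₁ = min {j > τₖ : w j = x}`, with
value `⊤` if there is no such `j`. -/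
noncomputable def visitTime {V : Type*} (w : ℕ → V) (x : V) : ℕ → ℕ∞
  | 0 => 0
  | k + 1 => ⨅ (j : ℕ) (_ : visitTime w x k < (j : ℕ∞) ∧ w j = x), (j : ℕ∞)

/-- The local chain at `x` of the trajectory `w`. For `k ≥ 1`, `L^x(k) = w (τₖ + 1)` is the exit that
follows the visit at time `τₖ` (meaningful when `τₖ < ⊤`). The initial state `L^x(0)` is the exit
`w 1 = w (τ₀ + 1)` if the trajectory starts at `x`, and otherwise it is the prescribed initial
state `ρ₀ x`. -/
noncomputable def localChain {V : Type*} [DecidableEq V] (w : ℕ → V) (ρ₀ : V → V) (x : V) : ℕ → V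
  | 0 => if w 0 = x then w 1 else ρ₀ x
  | k + 1 => w ((visitTime w x (k + 1)).toNat + 1)

/-- `X` is a locally Markov walk on the directed graph `G` with initial states `ρ₀`, whose local
chain at `x` has state space `{y | x → y}` and transition matrix `M x`. -/
structure IsLocallyMarkovWalk {V Ω : Type*} [Fintype V] [DecidableEq V] [MeasurableSpace V]
    [MeasurableSpace Ω] (G : Digraph V) (M : V → Matrix V V ℝ) (μ : Measure Ω)
    (X : ℕ → Ω → V) (ρ₀ : V → Ω → V) : Prop where
  measurable_walk : ∀ n, Measurable (X n)
  measurable_init : ∀ x, Measurable (ρ₀ x)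
  /-- The walk moves along the edges of `G`. -/
  walk_adj : ∀ᵐ ω ∂μ, ∀ n, G.Adj (X n ω) (X (n + 1) ω)
  /-- The initial states lie in the state spaces of the local chains. -/
  init_adj : ∀ᵐ ω ∂μ, ∀ x, G.Adj x (ρ₀ x ω)
  transition : ∀ x, IsTransitionMatrixOn {y | G.Adj x y} (M x)
  /-- For every `x`, the local chain at `x` is a Markov chain with transition matrix `M x`, for as
  long as it lasts: given that `x` is visited a `(k+1)`-st time and given `L^x(0), …, L^x(k)`, the
  value `L^x(k+1)` has law `M x (L^x(k), ·)`. If `x` is almost surely visited infinitely often,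
  then the events `τₖ₊₁ ≠ ⊤` can be omitted. -/
  markov : ∀ (x : V) (k : ℕ) (l : ℕ → V) (z : V),
    μ.real {ω | visitTime (X · ω) x (k + 1) ≠ ⊤ ∧
        (∀ i ≤ k, localChain (X · ω) (ρ₀ · ω) x i = l i) ∧
        localChain (X · ω) (ρ₀ · ω) x (k + 1) = z} =
      M x (l k) z *
        μ.real {ω | visitTime (X · ω) x (k + 1) ≠ ⊤ ∧
          ∀ i ≤ k, localChain (X · ω) (ρ₀ · ω) x i = l i}

/-!
The joint law of the local chains at different vertices is not prescribed, so the proof treats each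
local chain on its own by probability, and combines them along a fixed trajectory.

*Each local chain.* The increments `1{L (k+1) = z} - M (L k) z` of a Markov chain, restricted to
survival up to the `(k+1)`-st visit, are orthogonal to all functions of the past of the chain
(`integral_history_mul_increment_eq_zero`). A law of large numbers for bounded orthogonal sequences
(`ae_tendsto_average_zero_of_orthogonal`) shows that their averages vanish in the limit on the event
that the chain lasts forever. The empirical frequencies of the chain are therefore asymptotically
invariant under `M`; as the simplex is compact and the stationary distribution of `M` is unique
(`IsStationaryDistribution.eq_of_irreducibleOn`), they converge to it
(`tendsto_frequency_of_tendsto_average_increment`). This gives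
`IsLocallyMarkovWalk.ae_tendsto_localChain`.

*The walk.* Now fix a trajectory for which these limits hold at every vertex. Some vertex is visited
infinitely often, and from a vertex `x` that is visited infinitely often every out-neighbour `z` is
entered with positive frequency `Q x z` among the exits from `x`; by strong connectivity, all
vertices are visited infinitely often. Hence the jumps of the walk from `x` have the limiting
frequencies `Q x`, although the walk is not a Markov chain
(`tendsto_average_increment_of_localChain`), and the same compactness argument, applied to `Q` in
place of `M`, yields the convergence of the frequencies of visits to `π`.
-/

/-! ### Stationary distributions -/

/-- A nonnegative vector invariant under a nonnegative matrix is positive at every state that is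
reachable from a state at which it is positive. -/
lemma pos_of_reflTransGen_of_vecMul_eq {V : Type*} [Fintype V] {M : Matrix V V ℝ}
    (hM : ∀ y z, 0 ≤ M y z) {d : V → ℝ} (hd : ∀ y, 0 ≤ d y) (hdM : Matrix.vecMul d M = d)
    {y z : V} (hyz : Relation.ReflTransGen (fun a b => 0 < M a b) y z) (hy : 0 < d y) :
    0 < d z := by
  induction hyz with
  | refl => exact hy
  | @tail b c _ hbc ih =>
    rw [← hdM]
    simp only [Matrix.vecMul, dotProduct]
    exact Finset.sum_pos' (fun i _ => mul_nonneg (hd i) (hM i c))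
      ⟨b, Finset.mem_univ _, mul_pos ih hbc⟩

lemma IsStationaryDistribution.exists_pos {V : Type*} [Fintype V] {M : Matrix V V ℝ} {q : V → ℝ}
    (hq : IsStationaryDistribution q M) : ∃ y, 0 < q y := by
  by_contra! h
  have h1 := hq.1.2
  have h2 : ∑ y, q y ≤ 0 := Finset.sum_nonpos fun y _ => h y
  linarith

/-- Uniqueness of the stationary distribution of a matrix that is irreducible on `S`. -/
lemma IsStationaryDistribution.eq_of_irreducibleOn {V : Type*} [Fintype V] {S : Set V}
    {M : Matrix V V ℝ} (hM : ∀ y z, 0 ≤ M y z)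
    (hirr : ∀ y ∈ S, ∀ z ∈ S, Relation.ReflTransGen (fun a b => 0 < M a b) y z)
    {p q : V → ℝ} (hp : IsStationaryDistribution p M) (hq : IsStationaryDistribution q M)
    (hpS : ∀ y ∉ S, p y = 0) (hqS : ∀ y ∉ S, q y = 0) : p = q := by
  classical
  obtain ⟨y₀, hy₀⟩ := hq.exists_pos
  have hy₀S : y₀ ∈ S := by
    by_contra h
    exact hy₀.ne' (hqS y₀ h)
  have hqpos : ∀ y ∈ S, 0 < q y := fun y hy =>
    pos_of_reflTransGen_of_vecMul_eq hM hq.1.1 hq.2 (hirr y₀ hy₀S y hy) hy₀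
  obtain ⟨m, hm, hmin⟩ := (Finset.univ.filter (· ∈ S)).exists_min_image (fun y => p y / q y)
    ⟨y₀, by simpa using hy₀S⟩
  simp only [Finset.mem_filter, Finset.mem_univ, true_and] at hm hmin
  -- The vector `p - c • q`, for `c` the minimal ratio on `S`, is nonnegative, invariant, and
  -- vanishes at the minimiser `m`; hence it vanishes on `S`.
  set c := p m / q m with hc
  have hd : ∀ y, 0 ≤ (p - c • q) y := by
    intro y
    by_cases hy : y ∈ S
    · have := hmin y hy
      rw [le_div_iff₀ (hqpos y hy)] at this
      simpa using this
    · simp [hpS y hy, hqS y hy]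
  have hdM : Matrix.vecMul (p - c • q) M = p - c • q := by
    rw [Matrix.sub_vecMul, Matrix.smul_vecMul, hp.2, hq.2]
  have hdm : (p - c • q) m = 0 := by
    have := (hqpos m hm).ne'
    simp only [Pi.sub_apply, Pi.smul_apply, smul_eq_mul, hc]
    field_simp
    simp
  have hd0 : ∀ y, p y = c * q y := by
    intro y
    by_cases hy : y ∈ S
    · rcases (hd y).eq_or_lt with h | h
      · simp only [Pi.sub_apply, Pi.smul_apply, smul_eq_mul] at h
        linarith
      · exact absurd hdm (pos_of_reflTransGen_of_vecMul_eq hM hd hdM (hirr y hy m hm) h).ne'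
    · simp [hpS y hy, hqS y hy]
  have hc1 : c = 1 := by
    have h1 := hp.1.2
    simp only [hd0, ← Finset.mul_sum, hq.1.2, mul_one] at h1
    exact h1
  funext y
  rw [hd0, hc1, one_mul]

/-- Asymptotically invariant probability vectors converge to the stationary distribution as soon
as the latter is unique: by compactness of the simplex, it is their only cluster point. -/
lemma tendsto_of_tendsto_vecMul_sub {V : Type*} [Fintype V] {M : Matrix V V ℝ} {q : V → ℝ}
    (huniq : ∀ p, IsStationaryDistribution p M → p = q) {ν : ℕ → V → ℝ}
    (hν : ∀ᶠ n in atTop, ν n ∈ stdSimplex ℝ V)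
    (h : Tendsto (fun n => Matrix.vecMul (ν n) M - ν n) atTop (𝓝 0)) :
    Tendsto ν atTop (𝓝 q) := by
  refine (isCompact_stdSimplex ℝ V).tendsto_nhds_of_unique_mapClusterPt hν fun p hp hcl => ?_
  refine huniq p ⟨hp, ?_⟩
  have hcont : Continuous fun v : V → ℝ => Matrix.vecMul v M - v := by fun_prop
  have h1 : MapClusterPt (Matrix.vecMul p M - p) atTop (fun n => Matrix.vecMul (ν n) M - ν n) :=
    MapClusterPt.continuousAt_comp hcont.continuousAt hcl
  have h2 : ClusterPt (Matrix.vecMul p M - p) (𝓝 0) := h1.clusterPt.mono h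
  exact sub_eq_zero.mp (eq_of_nhds_neBot h2)

/-! ### A law of large numbers for orthogonal sequences -/

lemma integral_sq_sum_le_of_orthogonal {Ω : Type*} [MeasurableSpace Ω] {μ : Measure Ω}
    [IsProbabilityMeasure μ] {D : ℕ → Ω → ℝ} (hDm : ∀ k, Measurable (D k))
    (hD : ∀ k ω, |D k ω| ≤ 1) (horth : ∀ i j, i < j → ∫ ω, D i ω * D j ω ∂μ = 0) (n : ℕ) :
    ∫ ω, (∑ k ∈ Finset.range n, D k ω) ^ 2 ∂μ ≤ n := by
  have hint : ∀ i j, Integrable (fun ω => D i ω * D j ω) μ := fun i j =>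
    Integrable.of_bound ((hDm i).mul (hDm j)).aestronglyMeasurable 1 (.of_forall fun ω => by
      rw [Real.norm_eq_abs, abs_mul]
      exact mul_le_one₀ (hD i ω) (abs_nonneg _) (hD j ω))
  simp only [sq, Finset.sum_mul_sum]
  rw [integral_finsetSum _ fun i _ => integrable_finsetSum _ fun j _ => hint i j]
  calc _ ≤ ∑ i ∈ Finset.range n, (1 : ℝ) := Finset.sum_le_sum fun i hi => ?_
    _ = n := by simp
  rw [integral_finsetSum _ fun j _ => hint i j, Finset.sum_eq_single_of_mem i hi]
  · calc _ ≤ ∫ _, (1 : ℝ) ∂μ := integral_mono (hint i i) (integrable_const _) fun ω => ?_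
      _ = 1 := by simp
    have := hD i ω
    rw [← abs_mul_abs_self]
    exact mul_le_one₀ this (abs_nonneg _) this
  · intro j _ hji
    rcases hji.lt_or_gt with h | h
    · simpa only [mul_comm] using horth j i h
    · exact horth i j h

/-- The averages of a bounded orthogonal sequence tend to `0` almost surely. Along the squares this
follows from the summability of the second moments. -/
lemma ae_tendsto_average_zero_of_orthogonal {Ω : Type*} [MeasurableSpace Ω] {μ : Measure Ω}
    [IsProbabilityMeasure μ] {D : ℕ → Ω → ℝ} (hDm : ∀ k, Measurable (D k))
    (hD : ∀ k ω, |D k ω| ≤ 1) (horth : ∀ i j, i < j → ∫ ω, D i ω * D j ω ∂μ = 0) :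
    ∀ᵐ ω ∂μ, Tendsto (fun n : ℕ => (∑ k ∈ Finset.range n, D k ω) / n) atTop (𝓝 0) := by
  set S : ℕ → Ω → ℝ := fun n ω => ∑ k ∈ Finset.range n, D k ω with hS
  have hSm : ∀ n, Measurable (S n) := fun n => Finset.measurable_fun_sum _ fun k _ => hDm k
  have hSb : ∀ n ω, |S n ω| ≤ n := fun n ω => by
    calc _ ≤ ∑ k ∈ Finset.range n, |D k ω| := Finset.abs_sum_le_sum_abs _ _
      _ ≤ ∑ k ∈ Finset.range n, (1 : ℝ) := Finset.sum_le_sum fun k _ => hD k ω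
      _ = n := by simp
  set U : ℕ → Ω → ℝ := fun n ω => (S (n ^ 2) ω / ((n ^ 2 : ℕ) : ℝ)) ^ 2 with hU
  have hUm : ∀ n, Measurable (U n) := fun n => ((hSm _).div_const _).pow_const _
  have hUle : ∀ n, ∫⁻ ω, ENNReal.ofReal (U n ω) ∂μ ≤ ENNReal.ofReal (1 / (n : ℝ) ^ 2) := by
    intro n
    rw [← ofReal_integral_eq_lintegral_ofReal]
    · refine ENNReal.ofReal_le_ofReal ?_
      have := integral_sq_sum_le_of_orthogonal hDm hD horth (n ^ 2)
      simp only [hU, div_pow]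
      rw [integral_div]
      rcases Nat.eq_zero_or_pos n with rfl | hn
      · simp
      have hn' : (0 : ℝ) < n := by exact_mod_cast hn
      calc _ ≤ ((n ^ 2 : ℕ) : ℝ) / ((n ^ 2 : ℕ) : ℝ) ^ 2 := by gcongr
        _ = _ := by push_cast; field_simp
    · refine Integrable.of_bound (hUm n).aestronglyMeasurable 1 (.of_forall fun ω => ?_)
      simp only [hU, Real.norm_eq_abs, abs_pow, abs_div, Nat.abs_cast]
      exact pow_le_one₀ (by positivity) (div_le_one_of_le₀ (hSb _ _) (by positivity))
    · exact .of_forall fun ω => sq_nonneg _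
  have hfin : ∫⁻ ω, ∑' n, ENNReal.ofReal (U n ω) ∂μ ≠ ⊤ := by
    rw [lintegral_tsum fun n => (hUm n).ennreal_ofReal.aemeasurable]
    refine ne_top_of_le_ne_top ?_ (ENNReal.tsum_le_tsum hUle)
    rw [← ENNReal.ofReal_tsum_of_nonneg (fun n => by positivity)
      (Real.summable_one_div_nat_pow.mpr one_lt_two)]
    exact ENNReal.ofReal_ne_top
  filter_upwards [ae_lt_top (Measurable.tsum fun n => (hUm n).ennreal_ofReal) hfin]
    with ω hω
  have hU0 : Tendsto (fun n => U n ω) atTop (𝓝 0) := by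
    have h1 := ENNReal.tendsto_atTop_zero_of_tsum_ne_top hω.ne
    have h2 := (ENNReal.tendsto_toReal ENNReal.zero_ne_top).comp h1
    refine h2.congr fun n => ?_
    simp [hU, ENNReal.toReal_ofReal (sq_nonneg _)]
  have hsq : Tendsto (fun n : ℕ => S (n ^ 2) ω / ((n ^ 2 : ℕ) : ℝ)) atTop (𝓝 0) := by
    rw [tendsto_zero_iff_abs_tendsto_zero]
    have := hU0.sqrt
    simp only [hU, Real.sqrt_zero, Real.sqrt_sq_eq_abs] at this
    exact this
  -- `S n + n` is monotone in `n`, so convergence of its averages along the squares suffices.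
  have hmono : Monotone fun n => S n ω + n := by
    refine monotone_nat_of_le_succ fun n => ?_
    have := (abs_le.mp (hD n ω)).1
    simp only [hS, Finset.sum_range_succ]
    push_cast
    linarith
  have hratio : Tendsto (fun n : ℕ => (((n + 1) ^ 2 : ℕ) : ℝ) / ((n ^ 2 : ℕ) : ℝ)) atTop (𝓝 1) := by
    have h1 : Tendsto (fun n : ℕ => ((1 : ℝ) + 1 / (n : ℝ)) ^ 2) atTop (𝓝 ((1 + 0) ^ 2)) :=
      (tendsto_const_nhds.add tendsto_one_div_atTop_nhds_zero_nat).pow 2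
    rw [add_zero, one_pow] at h1
    refine h1.congr' ?_
    filter_upwards [eventually_gt_atTop 0] with n hn
    have hn' : (n : ℝ) ≠ 0 := by positivity
    push_cast
    field_simp
  have key := tendsto_div_of_monotone_of_exists_subseq_tendsto_div (fun n => S n ω + n) 1 hmono
    fun a ha => ⟨fun n => n ^ 2, ?_, tendsto_pow_atTop two_ne_zero, ?_⟩
  · have h2 := key.sub_const 1
    rw [sub_self] at h2
    refine h2.congr' ?_
    filter_upwards [eventually_gt_atTop 0] with n hn
    have hn' : (n : ℝ) ≠ 0 := by positivity
    field_simp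
    ring
  · filter_upwards [hratio.eventually_lt_const ha, eventually_gt_atTop 0] with n hn hn0
    have : (0 : ℝ) < ((n ^ 2 : ℕ) : ℝ) := by positivity
    exact ((div_lt_iff₀ this).mp hn).le
  · have h2 := hsq.add_const 1
    rw [zero_add] at h2
    refine h2.congr' ?_
    filter_upwards [eventually_gt_atTop 0] with n hn
    have hn' : (n : ℝ) ≠ 0 := by positivity
    push_cast
    field_simp

/-! ### Markov chains with a finite lifetime -/

/-- The increments `1{L (k+1) = z} - M (L k) z`, restricted to survival up to time `k + 1`, are
orthogonal to every function of the past. -/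
lemma integral_history_mul_increment_eq_zero {V Ω : Type*} [Fintype V] [DecidableEq V]
    [MeasurableSpace V] [DiscreteMeasurableSpace V] [MeasurableSpace Ω] {μ : Measure Ω}
    [IsProbabilityMeasure μ] {L : ℕ → Ω → V} {A : ℕ → Set Ω} {M : Matrix V V ℝ}
    (hL : ∀ k, Measurable (L k)) (hA : ∀ k, MeasurableSet (A k))
    (hmarkov : ∀ (k : ℕ) (l : ℕ → V) (z : V),
      μ.real {ω | ω ∈ A k ∧ (∀ i ≤ k, L i ω = l i) ∧ L (k + 1) ω = z} =
        M (l k) z * μ.real {ω | ω ∈ A k ∧ ∀ i ≤ k, L i ω = l i})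
    (k : ℕ) (z : V) (h : (Fin (k + 1) → V) → ℝ) :
    ∫ ω, h (fun i => L i ω) *
      (A k).indicator (fun ω => (if L (k + 1) ω = z then (1 : ℝ) else 0) - M (L k ω) z) ω ∂μ
      = 0 := by
  -- A history of length `k + 1` as a sequence; only its values at `i ≤ k` matter.
  set pad : (Fin (k + 1) → V) → ℕ → V := fun l i => l (Fin.ofNat (k + 1) i) with hpad
  have hofNat : ∀ i : Fin (k + 1), Fin.ofNat (k + 1) (i : ℕ) = i := fun i => by ext; simp
  have hhist : ∀ (l : Fin (k + 1) → V) (ω : Ω),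
      (∀ i ≤ k, L i ω = pad l i) ↔ (fun i : Fin (k + 1) => L i ω) = l := by
    intro l ω
    constructor
    · intro H
      funext i
      have := H i (by omega)
      simpa only [hpad, hofNat] using this
    · rintro rfl i hi
      simp only [hpad, Fin.val_ofNat]
      rw [Nat.mod_eq_of_lt (by omega)]
  set B : (Fin (k + 1) → V) → Set Ω := fun l => {ω | ω ∈ A k ∧ ∀ i ≤ k, L i ω = pad l i} with hB
  set C : (Fin (k + 1) → V) → Set Ω :=
    fun l => {ω | ω ∈ A k ∧ (∀ i ≤ k, L i ω = pad l i) ∧ L (k + 1) ω = z} with hC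
  have hpast : ∀ l, MeasurableSet {ω | ∀ i ≤ k, L i ω = pad l i} := fun l => by
    have : {ω | ∀ i ≤ k, L i ω = pad l i} = ⋂ i, ⋂ (_ : i ≤ k), L i ⁻¹' {pad l i} := by
      ext ω; simp
    rw [this]
    exact MeasurableSet.iInter fun i => MeasurableSet.iInter fun _ =>
      hL i (MeasurableSet.of_discrete)
  have hBm : ∀ l, MeasurableSet (B l) := fun l => (hA k).inter (hpast l)
  have hCm : ∀ l, MeasurableSet (C l) := fun l =>
    (hA k).inter ((hpast l).inter (hL (k + 1) (MeasurableSet.of_discrete (s := {z}))))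
  -- Split according to the history of the chain up to time `k`.
  have hdecomp : ∀ ω, h (fun i => L i ω) *
      (A k).indicator (fun ω => (if L (k + 1) ω = z then (1 : ℝ) else 0) - M (L k ω) z) ω =
      ∑ l, h l * ((C l).indicator 1 ω - M (pad l k) z * (B l).indicator 1 ω) := by
    intro ω
    by_cases hω : ω ∈ A k
    · rw [Finset.sum_eq_single_of_mem (fun i : Fin (k + 1) => L i ω) (Finset.mem_univ _)]
      · have hH := (hhist _ ω).mpr rfl
        have hlast := hH k le_rfl
        have hBω : ω ∈ B (fun i : Fin (k + 1) => L i ω) := ⟨hω, hH⟩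
        rw [Set.indicator_of_mem hω, Set.indicator_of_mem hBω, ← hlast]
        by_cases hz : L (k + 1) ω = z
        · have hCω : ω ∈ C (fun i : Fin (k + 1) => L i ω) := ⟨hω, hH, hz⟩
          rw [Set.indicator_of_mem hCω]
          simp [hz]
        · have hCω : ω ∉ C (fun i : Fin (k + 1) => L i ω) := fun H => hz H.2.2
          rw [Set.indicator_of_notMem hCω]
          simp [hz]
      · intro l _ hl
        have hBω : ω ∉ B l := fun H => hl ((hhist l ω).mp H.2).symm
        have hCω : ω ∉ C l := fun H => hl ((hhist l ω).mp H.2.1).symm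
        rw [Set.indicator_of_notMem hBω, Set.indicator_of_notMem hCω]
        simp
    · rw [Set.indicator_of_notMem hω, mul_zero, Finset.sum_eq_zero]
      intro l _
      have hBω : ω ∉ B l := fun H => hω H.1
      have hCω : ω ∉ C l := fun H => hω H.1
      rw [Set.indicator_of_notMem hBω, Set.indicator_of_notMem hCω]
      simp
  have hiB : ∀ l, Integrable ((B l).indicator (1 : Ω → ℝ)) μ := fun l =>
    (integrable_const (1 : ℝ)).indicator (hBm l)
  have hiC : ∀ l, Integrable ((C l).indicator (1 : Ω → ℝ)) μ := fun l =>
    (integrable_const (1 : ℝ)).indicator (hCm l)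
  have hint : ∀ l ∈ Finset.univ, Integrable (fun ω =>
      h l * ((C l).indicator 1 ω - M (pad l k) z * (B l).indicator 1 ω)) μ := fun l _ =>
    ((hiC l).sub ((hiB l).const_mul _)).const_mul _
  simp only [hdecomp]
  rw [integral_finsetSum _ hint]
  refine Finset.sum_eq_zero fun l _ => ?_
  rw [integral_const_mul, integral_sub (hiC l) ((hiB l).const_mul _), integral_const_mul,
    integral_indicator_one (hCm l), integral_indicator_one (hBm l)]
  simp only [hC, hB, hmarkov k (pad l) z, sub_self, mul_zero]

/-- On the event that a Markov chain survives forever, the number of its jumps to `z` is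
asymptotically the sum of the corresponding transition probabilities. -/
lemma ae_tendsto_average_increment_of_markov {V Ω : Type*} [Fintype V] [DecidableEq V]
    [MeasurableSpace V] [DiscreteMeasurableSpace V] [MeasurableSpace Ω] {μ : Measure Ω}
    [IsProbabilityMeasure μ] {L : ℕ → Ω → V} {A : ℕ → Set Ω} {M : Matrix V V ℝ}
    (hL : ∀ k, Measurable (L k)) (hA : ∀ k, MeasurableSet (A k)) (hanti : Antitone A)
    (hM0 : ∀ y z, 0 ≤ M y z) (hM1 : ∀ y z, M y z ≤ 1)
    (hmarkov : ∀ (k : ℕ) (l : ℕ → V) (z : V),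
      μ.real {ω | ω ∈ A k ∧ (∀ i ≤ k, L i ω = l i) ∧ L (k + 1) ω = z} =
        M (l k) z * μ.real {ω | ω ∈ A k ∧ ∀ i ≤ k, L i ω = l i}) (z : V) :
    ∀ᵐ ω ∂μ, (∀ k, ω ∈ A k) →
      Tendsto (fun n : ℕ => (∑ k ∈ Finset.range n,
        ((if L (k + 1) ω = z then (1 : ℝ) else 0) - M (L k ω) z)) / n) atTop (𝓝 0) := by
  set D : ℕ → Ω → ℝ := fun k =>
    (A k).indicator fun ω => (if L (k + 1) ω = z then (1 : ℝ) else 0) - M (L k ω) z with hD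
  have hDm : ∀ k, Measurable (D k) := fun k => by
    refine Measurable.indicator (Measurable.sub ?_ ?_) (hA k)
    · exact (Measurable.of_discrete (f := fun v : V => if v = z then (1 : ℝ) else 0)).comp
        (hL (k + 1))
    · exact (Measurable.of_discrete (f := fun v : V => M v z)).comp (hL k)
  have hDb : ∀ k ω, |D k ω| ≤ 1 := by
    intro k ω
    by_cases hω : ω ∈ A k
    · simp only [hD, Set.indicator_of_mem hω]
      have h0 := hM0 (L k ω) z
      have h1 := hM1 (L k ω) z
      split_ifs <;> rw [abs_le] <;> constructor <;> linarith
    · simp [hD, Set.indicator_of_notMem hω]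
  have horth : ∀ i j, i < j → ∫ ω, D i ω * D j ω ∂μ = 0 := by
    intro i j hij
    -- On the event `A j`, which is contained in `A i`, the factor `D i` is a function of the past.
    rw [← integral_history_mul_increment_eq_zero hL hA hmarkov j z fun l =>
      (if l ⟨i + 1, by omega⟩ = z then (1 : ℝ) else 0) - M (l ⟨i, by omega⟩) z]
    refine integral_congr_ae (.of_forall fun ω => ?_)
    by_cases hω : ω ∈ A j
    · simp only [hD, Set.indicator_of_mem hω, Set.indicator_of_mem (hanti hij.le hω)]
    · simp only [hD, Set.indicator_of_notMem hω, mul_zero]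
  filter_upwards [ae_tendsto_average_zero_of_orthogonal hDm hDb horth] with ω hω hall
  refine hω.congr fun n => ?_
  simp only [hD, Set.indicator_of_mem (hall _)]

/-! ### Empirical frequencies -/

lemma tendsto_average_shift_iff {g : ℕ → ℝ} {C : ℝ} (hg : ∀ k, |g k| ≤ C) {a : ℝ} :
    Tendsto (fun n : ℕ => (∑ k ∈ Finset.range n, g (k + 1)) / n) atTop (𝓝 a) ↔
      Tendsto (fun n : ℕ => (∑ k ∈ Finset.range n, g k) / n) atTop (𝓝 a) := by
  have hdiff : Tendsto (fun n : ℕ => (g n - g 0) / n) atTop (𝓝 0) := by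
    refine squeeze_zero_norm (fun n => ?_) (tendsto_const_div_atTop_nhds_zero_nat (C + C))
    rw [norm_div, Real.norm_eq_abs, Real.norm_natCast]
    gcongr
    exact (abs_sub _ _).trans (add_le_add (hg n) (hg 0))
  have heq : ∀ n : ℕ, (∑ k ∈ Finset.range n, g (k + 1)) / (n : ℝ) =
      (∑ k ∈ Finset.range n, g k) / n + (g n - g 0) / n := by
    intro n
    rw [← Finset.sum_range_sub, Finset.sum_sub_distrib]
    ring
  constructor <;> intro h
  · have := h.sub hdiff
    rw [sub_zero] at this
    exact this.congr fun n => by rw [heq]; ring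
  · have := h.add hdiff
    rw [add_zero] at this
    exact this.congr fun n => (heq n).symm

/-- If the jumps of a sequence asymptotically follow the transition probabilities `M`, then its
empirical frequencies converge to the unique stationary distribution of `M`. -/
lemma tendsto_frequency_of_tendsto_average_increment {V : Type*} [Fintype V] [DecidableEq V]
    {M : Matrix V V ℝ} {q : V → ℝ} (huniq : ∀ p, IsStationaryDistribution p M → p = q)
    {l : ℕ → V} (hl : ∀ z, Tendsto (fun n : ℕ => (∑ k ∈ Finset.range n,
        ((if l (k + 1) = z then (1 : ℝ) else 0) - M (l k) z)) / n) atTop (𝓝 0)) (z : V) :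
    Tendsto (fun n : ℕ => (∑ k ∈ Finset.range n, if l k = z then (1 : ℝ) else 0) / n) atTop
      (𝓝 (q z)) := by
  have key : Tendsto (fun (n : ℕ) (z : V) =>
      (∑ k ∈ Finset.range n, if l k = z then (1 : ℝ) else 0) / n) atTop (𝓝 q) := by
    refine tendsto_of_tendsto_vecMul_sub huniq ?_ ?_
    · filter_upwards [eventually_gt_atTop 0] with n hn
      have hn' : (n : ℝ) ≠ 0 := by positivity
      refine ⟨fun y => by positivity, ?_⟩
      rw [← Finset.sum_div, Finset.sum_comm]
      simp [hn']
    · rw [tendsto_pi_nhds]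
      intro y
      -- The shift by one step changes the averages by `O(1 / n)`.
      have hshift : Tendsto (fun n : ℕ => (∑ k ∈ Finset.range n,
          ((if l (k + 1) = y then (1 : ℝ) else 0) - if l k = y then (1 : ℝ) else 0)) / n)
          atTop (𝓝 0) := by
        simp only [Finset.sum_range_sub fun k => if l k = y then (1 : ℝ) else 0]
        refine squeeze_zero_norm (fun n => ?_) (tendsto_const_div_atTop_nhds_zero_nat 1)
        rw [norm_div, Real.norm_eq_abs, Real.norm_natCast]
        gcongr
        split_ifs <;> simp
      have := hshift.sub (hl y)
      rw [sub_zero] at this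
      refine this.congr fun n => ?_
      have hmul : Matrix.vecMul
          (fun z => (∑ k ∈ Finset.range n, if l k = z then (1 : ℝ) else 0) / (n : ℝ)) M y =
          (∑ k ∈ Finset.range n, M (l k) y) / n := by
        simp only [Matrix.vecMul, dotProduct, div_mul_eq_mul_div, ← Finset.sum_div,
          Finset.sum_mul]
        rw [Finset.sum_comm]
        simp
      rw [Pi.sub_apply, hmul, ← sub_div, ← sub_div, ← Finset.sum_sub_distrib,
        ← Finset.sum_sub_distrib]
      congr 1
      exact Finset.sum_congr rfl fun k _ => by ring
  exact (tendsto_pi_nhds.mp key) z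

/-! ### Visit times and visit counts -/

lemma measurable_visitTime {V Ω : Type*} [MeasurableSpace V] [DiscreteMeasurableSpace V]
    [MeasurableSpace Ω] {X : ℕ → Ω → V} (hX : ∀ n, Measurable (X n)) (x : V) (k : ℕ) :
    Measurable fun ω => visitTime (X · ω) x k := by
  classical
  have : BorelSpace ℕ∞ := ⟨borel_eq_top_of_countable.symm⟩
  induction k with
  | zero => exact measurable_const
  | succ k ih =>
    simp only [visitTime, iInf_eq_if]
    refine Measurable.iInf fun j => Measurable.ite ?_ measurable_const measurable_const
    exact (ih (MeasurableSet.of_discrete (s := Set.Iio (j : ℕ∞)))).inter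
      (hX j (MeasurableSet.of_discrete (s := {x})))

lemma measurable_localChain {V Ω : Type*} [Fintype V] [DecidableEq V] [MeasurableSpace V]
    [DiscreteMeasurableSpace V] [MeasurableSpace Ω] {X : ℕ → Ω → V} {ρ₀ : V → Ω → V}
    (hX : ∀ n, Measurable (X n)) (hρ₀ : ∀ x, Measurable (ρ₀ x)) (x : V) (k : ℕ) :
    Measurable fun ω => localChain (X · ω) (ρ₀ · ω) x k := by
  cases k with
  | zero =>
    exact Measurable.ite (hX 0 (MeasurableSet.of_discrete (s := {x}))) (hX 1) (hρ₀ x)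
  | succ k =>
    have h1 : Measurable fun p : Ω × ℕ => X (p.2 + 1) p.1 :=
      measurable_from_prod_countable_left fun n => hX (n + 1)
    exact h1.comp (measurable_id.prodMk
      ((Measurable.of_discrete (f := ENat.toNat)).comp (measurable_visitTime hX x (k + 1))))

lemma monotone_visitTime {V : Type*} (w : ℕ → V) (x : V) : Monotone (visitTime w x) :=
  monotone_nat_of_le_succ fun k => by
    rw [visitTime]
    exact le_iInf fun j => le_iInf fun hj => hj.1.le

/-- The number of visits of the trajectory `w` to `x` at the times `1, …, t`. The visit at time `0`
is not counted, in accordance with `visitTime`. -/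
def visitCount {V : Type*} [DecidableEq V] (w : ℕ → V) (x : V) (t : ℕ) : ℕ :=
  ((Finset.range t).filter fun n => w (n + 1) = x).card

lemma visitCount_succ {V : Type*} [DecidableEq V] (w : ℕ → V) (x : V) (t : ℕ) :
    visitCount w x (t + 1) = visitCount w x t + if w (t + 1) = x then 1 else 0 := by
  simp only [visitCount, Finset.card_filter, Finset.sum_range_succ]

lemma cast_visitCount {V : Type*} [DecidableEq V] (w : ℕ → V) (x : V) (t : ℕ) :
    (visitCount w x t : ℝ) = ∑ n ∈ Finset.range t, if w (n + 1) = x then (1 : ℝ) else 0 := by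
  simp [visitCount]

lemma monotone_visitCount {V : Type*} [DecidableEq V] (w : ℕ → V) (x : V) :
    Monotone (visitCount w x) :=
  monotone_nat_of_le_succ fun t => by rw [visitCount_succ]; exact Nat.le_add_right _ _

lemma visitCount_le {V : Type*} [DecidableEq V] (w : ℕ → V) (x : V) (t : ℕ) :
    visitCount w x t ≤ t :=
  (Finset.card_filter_le _ _).trans_eq (Finset.card_range t)

lemma visitTime_succ_eq {V : Type*} {w : ℕ → V} {x : V} {k s t : ℕ}
    (hs : visitTime w x k = s) (hst : s ≤ t) (hno : ∀ j, s < j → j ≤ t → w j ≠ x)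
    (ht : w (t + 1) = x) : visitTime w x (k + 1) = (t + 1 : ℕ) := by
  rw [visitTime, hs]
  refine le_antisymm (iInf₂_le (t + 1) ⟨by exact_mod_cast Nat.lt_succ_of_le hst, ht⟩) ?_
  refine le_iInf₂ fun j hj => ?_
  by_contra h
  have h1 : s < j := by exact_mod_cast hj.1
  have h2 : j < t + 1 := by exact_mod_cast not_le.mp h
  exact hno j h1 (by omega) hj.2

/-- The visit time with index `visitCount w x t` is the last visit to `x` up to time `t`. -/
lemma exists_visitTime_visitCount_eq {V : Type*} [DecidableEq V] (w : ℕ → V) (x : V) (t : ℕ) :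
    ∃ s ≤ t, visitTime w x (visitCount w x t) = (s : ℕ∞) ∧ ∀ j, s < j → j ≤ t → w j ≠ x := by
  induction t with
  | zero => exact ⟨0, le_rfl, by simp [visitCount, visitTime], fun j h1 h2 => by omega⟩
  | succ t ih =>
    obtain ⟨s, hst, hs, hno⟩ := ih
    rw [visitCount_succ]
    by_cases h : w (t + 1) = x
    · rw [if_pos h]
      exact ⟨t + 1, le_rfl, visitTime_succ_eq hs hst hno h, fun j h1 h2 => by omega⟩
    · rw [if_neg h]
      refine ⟨s, by omega, hs, fun j h1 h2 => ?_⟩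
      rcases Nat.lt_or_ge t j with h3 | h3
      · obtain rfl : j = t + 1 := by omega
        exact h
      · exact hno j h1 h3

lemma visitTime_ne_top {V : Type*} [DecidableEq V] {w : ℕ → V} {x : V}
    (h : Tendsto (visitCount w x) atTop atTop) (k : ℕ) : visitTime w x k ≠ ⊤ := by
  obtain ⟨t, ht⟩ := (h.eventually_ge_atTop k).exists
  obtain ⟨s, -, hs, -⟩ := exists_visitTime_visitCount_eq w x t
  have := (monotone_visitTime w x ht).trans_eq hs
  exact (this.trans_lt (ENat.natCast_lt_top s)).ne

/-- Summing over the exits from `x` is summing over the local chain at `x`. -/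
lemma sum_exits_eq_sum_localChain {V : Type*} [DecidableEq V] (w : ℕ → V) (ρ₀ : V → V) (x : V)
    (g : V → ℝ) (t : ℕ) :
    ∑ n ∈ Finset.range t, (if w (n + 1) = x then g (w (n + 2)) else 0) =
      ∑ k ∈ Finset.range (visitCount w x t), g (localChain w ρ₀ x (k + 1)) := by
  induction t with
  | zero => simp [visitCount]
  | succ t ih =>
    rw [Finset.sum_range_succ, ih, visitCount_succ]
    by_cases h : w (t + 1) = x
    · obtain ⟨s, hst, hs, hno⟩ := exists_visitTime_visitCount_eq w x t
      rw [if_pos h, if_pos h, Finset.sum_range_succ, localChain,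
        visitTime_succ_eq hs hst hno h, ENat.toNat_natCast]
    · rw [if_neg h, if_neg h, add_zero, add_zero]

/-- Some vertex is visited infinitely often, by the pigeonhole principle. -/
lemma exists_tendsto_visitCount {V : Type*} [Fintype V] [DecidableEq V] (w : ℕ → V) :
    ∃ x, Tendsto (visitCount w x) atTop atTop := by
  by_contra! h
  have hb : ∀ x, ∃ b, ∀ t, visitCount w x t < b := by
    intro x
    by_contra! hx
    exact h x ((monotone_visitCount w x).tendsto_atTop_atTop hx)
  choose b hb using hb
  have hsum : ∑ x, visitCount w x (∑ x, b x) = ∑ x, b x := by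
    simp only [visitCount]
    rw [← Finset.card_eq_sum_card_fiberwise fun _ _ => Finset.mem_univ _, Finset.card_range]
  exact absurd hsum (Finset.sum_lt_sum_of_nonempty ⟨w 0, Finset.mem_univ _⟩ fun x _ =>
    hb x _).ne

/-! ### Recurrence and global frequencies -/

/-- If `x` is visited infinitely often and the local chain at `x` takes the value `z` with positive
frequency, then `z` is visited infinitely often. -/
lemma tendsto_visitCount_of_localChain {V : Type*} [DecidableEq V] {w : ℕ → V} {ρ₀ : V → V}
    {x z : V} {a : ℝ} (ha : 0 < a) (hx : Tendsto (visitCount w x) atTop atTop)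
    (hlim : Tendsto (fun n : ℕ => (∑ k ∈ Finset.range n,
      if localChain w ρ₀ x (k + 1) = z then (1 : ℝ) else 0) / n) atTop (𝓝 a)) :
    Tendsto (visitCount w z) atTop atTop := by
  have h1 : Tendsto (fun n : ℕ => ∑ k ∈ Finset.range n,
      if localChain w ρ₀ x (k + 1) = z then (1 : ℝ) else 0) atTop atTop := by
    refine (Tendsto.atTop_mul_pos ha tendsto_natCast_atTop_atTop hlim).congr' ?_
    filter_upwards [eventually_gt_atTop 0] with n hn
    have hn' : (n : ℝ) ≠ 0 := by positivity
    field_simp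
  have h2 : Tendsto (fun t => (visitCount w z (t + 1) : ℝ)) atTop atTop := by
    refine tendsto_atTop_mono (fun t => ?_) (h1.comp hx)
    have h3 := sum_exits_eq_sum_localChain w ρ₀ x (fun v => if v = z then (1 : ℝ) else 0) t
    simp only [Function.comp_apply]
    rw [← h3, cast_visitCount, Finset.sum_range_succ']
    refine (Finset.sum_le_sum fun n _ => ?_).trans (le_add_of_nonneg_right (by positivity))
    split_ifs <;> simp_all
  exact (tendsto_add_atTop_iff_nat (f := visitCount w z) 1).mp (tendsto_natCast_atTop_iff.mp h2)

/-- If every vertex is visited infinitely often and the local chains have the limiting frequencies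
`Q`, then the jumps of the walk asymptotically follow the transition probabilities `Q`. -/
lemma tendsto_average_increment_of_localChain {V : Type*} [Fintype V] [DecidableEq V] {w : ℕ → V}
    {ρ₀ : V → V} {Q : Matrix V V ℝ} {z : V}
    (hrec : ∀ x, Tendsto (visitCount w x) atTop atTop)
    (hlim : ∀ x, Tendsto (fun n : ℕ => (∑ k ∈ Finset.range n,
      if localChain w ρ₀ x (k + 1) = z then (1 : ℝ) else 0) / n) atTop (𝓝 (Q x z))) :
    Tendsto (fun n : ℕ => (∑ k ∈ Finset.range n,
      ((if w (k + 2) = z then (1 : ℝ) else 0) - Q (w (k + 1)) z)) / n) atTop (𝓝 0) := by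
  set c : V → ℕ → ℝ := fun x n => ∑ k ∈ Finset.range n,
    if localChain w ρ₀ x (k + 1) = z then (1 : ℝ) else 0 with hc
  -- Split the jumps according to the vertex from which they start.
  have hsplit : ∀ n : ℕ, (∑ k ∈ Finset.range n,
      ((if w (k + 2) = z then (1 : ℝ) else 0) - Q (w (k + 1)) z)) / n =
      ∑ x, (visitCount w x n : ℝ) / n * (c x (visitCount w x n) / visitCount w x n - Q x z) := by
    intro n
    have h1 : ∀ x, (visitCount w x n : ℝ) / n *
        (c x (visitCount w x n) / visitCount w x n - Q x z) =
        (∑ k ∈ Finset.range n, if w (k + 1) = x then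
          ((if w (k + 2) = z then (1 : ℝ) else 0) - Q x z) else 0) / n := by
      intro x
      have h2 : ∑ k ∈ Finset.range n, (if w (k + 1) = x then
          ((if w (k + 2) = z then (1 : ℝ) else 0) - Q x z) else 0) =
          c x (visitCount w x n) - visitCount w x n * Q x z := by
        have h3 := sum_exits_eq_sum_localChain w ρ₀ x
          (fun v => (if v = z then (1 : ℝ) else 0) - Q x z) n
        rw [h3, Finset.sum_sub_distrib]
        simp [hc]
      rw [h2]
      rcases Nat.eq_zero_or_pos (visitCount w x n) with h0 | h0
      · simp [h0, hc]
      · have : (visitCount w x n : ℝ) ≠ 0 := by positivity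
        field_simp
    simp only [h1]
    rw [← Finset.sum_div, Finset.sum_comm]
    simp
  simp only [hsplit]
  rw [← Finset.sum_const_zero (s := (Finset.univ : Finset V))]
  refine tendsto_finsetSum _ fun x _ => ?_
  have h1 : Tendsto (fun n => c x (visitCount w x n) / visitCount w x n - Q x z) atTop (𝓝 0) := by
    have := ((hlim x).comp (hrec x)).sub_const (Q x z)
    rw [sub_self] at this
    exact this
  refine squeeze_zero_norm (fun n => ?_) (tendsto_zero_iff_norm_tendsto_zero.mp h1)
  rw [norm_mul]
  refine mul_le_of_le_one_left (norm_nonneg _) ?_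
  rw [norm_div, Real.norm_natCast, Real.norm_natCast]
  exact div_le_one_of_le₀ (by exact_mod_cast visitCount_le w x n) (by positivity)

/-! ### Transition matrices with positive entries -/

lemma IsTransitionMatrixOn.le_one {V : Type*} [Fintype V] {S : Set V} {M : Matrix V V ℝ}
    (hM : IsTransitionMatrixOn S M) (y z : V) : M y z ≤ 1 := by
  by_cases hy : y ∈ S
  · rw [← hM.row_sum y hy]
    exact Finset.single_le_sum (fun i _ => hM.nonneg y i) (Finset.mem_univ z)
  · rw [hM.zero_row y hy z]
    exact zero_le_one

lemma IsTransitionMatrixOn.stationary_eq_zero {V : Type*} [Fintype V] {S : Set V}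
    {M : Matrix V V ℝ} (hM : IsTransitionMatrixOn S M) {q : V → ℝ}
    (hq : IsStationaryDistribution q M) {z : V} (hz : z ∉ S) : q z = 0 := by
  rw [← hq.2]
  simp [Matrix.vecMul, dotProduct, hM.zero_col z hz]

lemma IsTransitionMatrixOn.stationary_pos {V : Type*} [Fintype V] {S : Set V}
    {M : Matrix V V ℝ} (hM : IsTransitionMatrixOn S M) (hpos : ∀ y ∈ S, ∀ z ∈ S, 0 < M y z)
    {q : V → ℝ} (hq : IsStationaryDistribution q M) {z : V} (hz : z ∈ S) : 0 < q z := by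
  obtain ⟨y, hy⟩ := hq.exists_pos
  have hyS : y ∈ S := by
    by_contra h
    exact hy.ne' (hM.stationary_eq_zero hq h)
  exact pos_of_reflTransGen_of_vecMul_eq hM.nonneg hq.1.1 hq.2 (.single (hpos y hyS z hz)) hy

lemma IsTransitionMatrixOn.stationary_unique {V : Type*} [Fintype V] {S : Set V}
    {M : Matrix V V ℝ} (hM : IsTransitionMatrixOn S M) (hpos : ∀ y ∈ S, ∀ z ∈ S, 0 < M y z)
    {p q : V → ℝ} (hp : IsStationaryDistribution p M) (hq : IsStationaryDistribution q M) :
    p = q :=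
  hp.eq_of_irreducibleOn hM.nonneg (fun y hy z hz => .single (hpos y hy z hz)) hq
    (fun _ h => hM.stationary_eq_zero hp h) fun _ h => hM.stationary_eq_zero hq h

/-! ### Locally Markov walks -/

/-- The ergodic theorem for the local chain at a vertex that is visited infinitely often. -/
lemma IsLocallyMarkovWalk.ae_tendsto_localChain {V Ω : Type*} [Fintype V] [DecidableEq V]
    [MeasurableSpace V] [DiscreteMeasurableSpace V] [MeasurableSpace Ω] {μ : Measure Ω}
    [IsProbabilityMeasure μ] {G : Digraph V} {M : V → Matrix V V ℝ} {X : ℕ → Ω → V}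
    {ρ₀ : V → Ω → V} (hX : IsLocallyMarkovWalk G M μ X ρ₀) {x : V} {q : V → ℝ}
    (huniq : ∀ p, IsStationaryDistribution p (M x) → p = q) :
    ∀ᵐ ω ∂μ, Tendsto (visitCount (X · ω) x) atTop atTop →
      ∀ z, Tendsto (fun n : ℕ => (∑ k ∈ Finset.range n,
        if localChain (X · ω) (ρ₀ · ω) x (k + 1) = z then (1 : ℝ) else 0) / n) atTop
        (𝓝 (q z)) := by
  have hA : ∀ k, MeasurableSet {ω | visitTime (X · ω) x (k + 1) ≠ ⊤} := fun k =>
    measurable_visitTime hX.measurable_walk x (k + 1) (MeasurableSet.of_discrete (s := {⊤}ᶜ))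
  have hanti : Antitone fun k => {ω | visitTime (X · ω) x (k + 1) ≠ ⊤} := fun i j hij ω hω =>
    ne_top_of_le_ne_top hω (monotone_visitTime _ x (by omega))
  have h := fun z => ae_tendsto_average_increment_of_markov
    (measurable_localChain hX.measurable_walk hX.measurable_init x) hA hanti
    (hX.transition x).nonneg (hX.transition x).le_one (hX.markov x) z
  filter_upwards [ae_all_iff.mpr h] with ω hω hinf z
  rw [tendsto_average_shift_iff (C := 1)
    (g := fun k => if localChain (X · ω) (ρ₀ · ω) x k = z then (1 : ℝ) else 0)
    fun k => by split_ifs <;> simp]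
  exact tendsto_frequency_of_tendsto_average_increment huniq
    (fun z => hω z fun k => visitTime_ne_top hinf (k + 1)) z

theorem mainTheorem2 {V Ω : Type*} [Fintype V] [DecidableEq V]
    [MeasurableSpace V] [DiscreteMeasurableSpace V] [MeasurableSpace Ω]
    (μ : Measure Ω) [IsProbabilityMeasure μ]
    (G : Digraph V) (hG : G.IsStronglyConnected)
    (M : V → Matrix V V ℝ) (X : ℕ → Ω → V) (ρ₀ : V → Ω → V)
    (hX : IsLocallyMarkovWalk G M μ X ρ₀)
    (hM : ∀ x y z, G.Adj x y → G.Adj x z → 0 < M x y z)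
    (Q : Matrix V V ℝ) (hQ : ∀ x, IsStationaryDistribution (Q.row x) (M x))
    (π : V → ℝ) (hπ : IsStationaryDistribution π Q) :
    (∀ f : V → ℝ, ∀ᵐ ω ∂μ,
      Tendsto (fun t : ℕ => (1 / (t : ℝ)) * ∑ n ∈ Finset.range (t + 1), f (X n ω)) atTop
        (𝓝 (∑ x, f x * π x))) ∧
    (∀ x : V, ∀ᵐ ω ∂μ,
      Tendsto (fun t : ℕ => (((Finset.range t).filter (fun n => X n ω = x)).card : ℝ) / (t : ℝ))
        atTop (𝓝 (π x))) := by
  have hMpos : ∀ x, ∀ y ∈ {y | G.Adj x y}, ∀ z ∈ {y | G.Adj x y}, 0 < M x y z :=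
    fun x y hy z hz => hM x y z hy hz
  have hQpos : ∀ x z, G.Adj x z → 0 < Q x z := fun x z hxz =>
    (hX.transition x).stationary_pos (hMpos x) (hQ x) hxz
  have hπuniq : ∀ p, IsStationaryDistribution p Q → p = π := fun p hp =>
    hp.eq_of_irreducibleOn (S := Set.univ) (fun x z => (hQ x).1.1 z)
      (fun x _ z _ => Relation.ReflTransGen.mono (fun a b => hQpos a b) _ _ (hG x z)) hπ
      (fun _ h => absurd (Set.mem_univ _) h) fun _ h => absurd (Set.mem_univ _) h
  have hlocal := fun x => hX.ae_tendsto_localChain (x := x) (q := Q x) fun p hp =>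
    (hX.transition x).stationary_unique (hMpos x) hp (hQ x)
  have hfreq : ∀ᵐ ω ∂μ, ∀ x, Tendsto (fun n : ℕ =>
      (∑ k ∈ Finset.range n, if X k ω = x then (1 : ℝ) else 0) / n) atTop (𝓝 (π x)) := by
    filter_upwards [ae_all_iff.mpr hlocal] with ω hω x
    have hrec : ∀ y, Tendsto (visitCount (X · ω) y) atTop atTop := by
      intro y
      obtain ⟨y₀, hy₀⟩ := exists_tendsto_visitCount (X · ω)
      have hpath := hG y₀ y
      induction hpath with
      | refl => exact hy₀
      | @tail b c _ hbc ih =>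
        exact tendsto_visitCount_of_localChain (w := (X · ω)) (ρ₀ := (ρ₀ · ω)) (hQpos b c hbc) ih
          (hω b ih c)
    have hincr := fun z => tendsto_average_increment_of_localChain (w := (X · ω)) (ρ₀ := (ρ₀ · ω))
      (Q := Q) (z := z) hrec fun y => hω y (hrec y) z
    rw [← tendsto_average_shift_iff (C := 1) (g := fun k => if X k ω = x then (1 : ℝ) else 0)
      fun k => by split_ifs <;> simp]
    exact tendsto_frequency_of_tendsto_average_increment (l := fun k => X (k + 1) ω) hπuniq
      hincr x
  refine ⟨fun f => ?_, fun x => ?_⟩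
  · filter_upwards [hfreq] with ω hω
    have h1 : Tendsto (fun n : ℕ => (∑ k ∈ Finset.range n, f (X k ω)) / n) atTop
        (𝓝 (∑ x, f x * π x)) := by
      refine (tendsto_finsetSum Finset.univ fun x _ => (hω x).const_mul (f x)).congr fun n => ?_
      simp only [mul_div_assoc', ← Finset.sum_div, Finset.mul_sum]
      rw [Finset.sum_comm]
      simp
    rw [← tendsto_average_shift_iff (C := ∑ x, |f x|) (g := fun k => f (X k ω)) fun k =>
      Finset.single_le_sum (f := fun x => |f x|) (fun x _ => abs_nonneg _)
        (Finset.mem_univ (X k ω))] at h1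
    have h2 := h1.add (tendsto_const_div_atTop_nhds_zero_nat (f (X 0 ω)))
    rw [add_zero] at h2
    refine h2.congr fun n => ?_
    rw [Finset.sum_range_succ']
    ring
  · filter_upwards [hfreq] with ω hω
    refine (hω x).congr fun n => ?_
    simp
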